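/- Let $G$ be a locally compact second countable group. A $G$-space is a standard Borel probability space $(X,\nu)$ with a measurable action of $G$ such that each $g\in G$ preserves the class of $\nu$-null sets; $g\nu(E)=\nu(g^{-1}E)$. A $G$-map $\pi:(X,\nu)\to(Y,\eta)$ is a measurable map with $\pi_*\nu=\eta$ such that for every $g\in G$, $\pi(gx)=g\pi(x)$ for $\nu$-almost every $x$. A $G$-isomorphism is a $G$-map that has an almost everywhere inverse $G$-map. A disintegration of $\nu$ over $\eta$ via $\pi$ is a measurable map $D_\pi:Y\to P(X)$ such that $D_\pi(y)$ is carried by $\pi^{-1}(y)$ for almost every $y$ and $\int_Y D_\pi(y)\,d\eta(y)=\nu$; it exists and is unique up to an $\eta$-null set. The $G$-map $\pi$ is relatively measure-preserving if for every $g\in G$, $D_\pi(gy)=gD_\pi(y)$ for almost every $y$. It is relatively contractive if (for every version $D_\pi$ of the disintegration) for almost every $y\in Y$ and every measurable $B\subseteq X$ with $D_\pi(y)(B)>0$ one has $\sup_{g\in G}\,g^{-1}D_\pi(gy)(B)=1$. Corollary. Let $(X,\nu),(Y,\eta),(Z,\zeta),(W,\rho)$ be $G$-spaces and let $\psi:(W,\rho)\to(X,\nu)$,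 $\tau:(W,\rho)\to(Y,\eta)$, $\pi:(X,\nu)\to(Z,\zeta)$, $\varphi:(Y,\eta)\to(Z,\zeta)$ be $G$-maps with $\pi\circ\psi=\varphi\circ\tau$ $\rho$-almost everywhere. If $\tau$ and $\pi$ are relatively measure-preserving and $\psi$ and $\varphi$ are relatively contractive, then $(W,\rho)$ is $G$-isomorphic to the independent relative joining of $(X,\nu)$ and $(Y,\eta)$ over $(Z,\zeta)$, that is, to $X\times Y$ with the diagonal $G$-action and the measure $$\int_Z D_\pi(z)\times D_\varphi(z)\,d\zeta(z),$$ which in particular is quasi-invariant, so that it is a $G$-space. -/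

import Mathlib

open MeasureTheory ProbabilityTheory

namespace GSpaces

/-- The translate `gν` of a measure: `gν(E) = ν(g⁻¹E)`. -/
noncomputable def translate {G X : Type*} [SMul G X] [MeasurableSpace X]
    (g : G) (ν : Measure X) : Measure X :=
  ν.map (fun x => g • x)

/-- `(X, ν)` is a `G`-space: `ν` is a probability measure whose class of null sets is preserved
by every element of `G`. (That `X` is standard Borel and that the action is measurable is
expressed by type classes.) -/
structure IsGSpace (G : Type*) {X : Type*} [SMul G X] [MeasurableSpace X]
    (ν : Measure X) : Prop where
  isProbabilityMeasure : IsProbabilityMeasure ν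
  translate_absolutelyContinuous : ∀ g : G, translate g ν ≪ ν
  absolutelyContinuous_translate : ∀ g : G, ν ≪ translate g ν

/-- `π : (X, ν) → (Y, η)` is a `G`-map. -/
structure IsGMap (G : Type*) {X Y : Type*} [SMul G X] [SMul G Y]
    [MeasurableSpace X] [MeasurableSpace Y]
    (ν : Measure X) (η : Measure Y) (π : X → Y) : Prop where
  measurable : Measurable π
  map_eq : ν.map π = η
  equivariant : ∀ g : G, ∀ᵐ x ∂ν, π (g • x) = g • π x

/-- `(X, ν)` and `(Y, η)` are `G`-isomorphic: there are `G`-maps in both directions that are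
inverse to each other almost everywhere. -/
def GIsomorphic (G : Type*) {X Y : Type*} [SMul G X] [SMul G Y]
    [MeasurableSpace X] [MeasurableSpace Y] (ν : Measure X) (η : Measure Y) : Prop :=
  ∃ (f : X → Y) (h : Y → X), IsGMap G ν η f ∧ IsGMap G η ν h ∧
    (∀ᵐ x ∂ν, h (f x) = x) ∧ (∀ᵐ y ∂η, f (h y) = y)

/-- `D : Y → P(X)` is (a version of) the disintegration of `ν` over `η` via `π`: `D y` is a
probability measure carried by the fiber `π⁻¹(y)` for almost every `y`, and `∫ D y dη(y) = ν`. -/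
structure IsDisintegration {X Y : Type*} [MeasurableSpace X] [MeasurableSpace Y]
    (ν : Measure X) (η : Measure Y) (π : X → Y) (D : Kernel Y X) : Prop where
  isMarkovKernel : IsMarkovKernel D
  fiber : ∀ᵐ y ∂η, D y (π ⁻¹' {y})ᶜ = 0
  bind_eq : η.bind D = ν

/-- Disintegrations exist, so the quantifiers over them below are never vacuous. -/
theorem exists_isDisintegration {X Y : Type*} [MeasurableSpace X] [StandardBorelSpace X]
    [MeasurableSpace Y] [StandardBorelSpace Y] (ν : Measure X) [IsProbabilityMeasure ν]
    {π : X → Y} (hπ : Measurable π) :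
    ∃ D : Kernel Y X, IsDisintegration ν (ν.map π) π D := by
  have : Nonempty X := nonempty_of_isProbabilityMeasure ν
  have key : (ν.map π) ⊗ₘ condDistrib id π ν = ν.map (fun x => (π x, x)) :=
    compProd_map_condDistrib aemeasurable_id
  have hmeas : Measurable fun x : X => (π x, x) := hπ.prodMk measurable_id
  have : IsProbabilityMeasure (ν.map π) := Measure.isProbabilityMeasure_map hπ.aemeasurable
  refine ⟨condDistrib id π ν, inferInstance, ?_, ?_⟩
  · have hS : MeasurableSet {q : Y × X | ¬ π q.2 = q.1} :=
      (measurableSet_eq_fun (hπ.comp measurable_snd) measurable_fst).compl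
    have h0 : ((ν.map π) ⊗ₘ condDistrib id π ν) {q : Y × X | ¬ π q.2 = q.1} = 0 := by
      rw [key, Measure.map_apply hmeas hS]
      simp
    have h0 := Measure.ae_ae_of_ae_compProd (p := fun q : Y × X => π q.2 = q.1) h0
    filter_upwards [h0] with y hy
    exact hy
  · have h := Measure.snd_compProd (ν.map π) (condDistrib id π ν)
    rw [key, Measure.snd, Measure.map_map measurable_snd hmeas] at h
    rw [← h]
    exact Measure.map_id

/-- The conjugated disintegration measure `D^{(g)}(y) = g⁻¹ D(gy)`. -/
noncomputable def conjugated {G X Y : Type*} [Group G] [SMul G X] [SMul G Y]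
    [MeasurableSpace X] [MeasurableSpace Y] (D : Kernel Y X) (g : G) (y : Y) : Measure X :=
  translate g⁻¹ (D (g • y))

/-- `π` is relatively measure-preserving: its disintegration is `G`-equivariant,
`D(gy) = g D(y)` for all `g` and almost every `y`. -/
def IsRelMeasurePreserving (G : Type*) {X Y : Type*} [SMul G X] [SMul G Y]
    [MeasurableSpace X] [MeasurableSpace Y]
    (ν : Measure X) (η : Measure Y) (π : X → Y) : Prop :=
  ∀ D : Kernel Y X, IsDisintegration ν η π D →
    ∀ g : G, ∀ᵐ y ∂η, D (g • y) = translate g (D y)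

/-- `π` is relatively contractive: for almost every `y`, every measurable `B` with `D(y)(B) > 0`
satisfies `sup_g D^{(g)}(y)(B) = 1`.

The disintegration `D` is only determined up to a null set of `y`, whereas for uncountable `G`
the supremum may run through all values of `D`, also those on a null set. The condition is
therefore required of every version of the disintegration; only so is it a property of `π`. -/
def IsRelContractive (G : Type*) {X Y : Type*} [Group G] [SMul G X] [SMul G Y]
    [MeasurableSpace X] [MeasurableSpace Y]
    (ν : Measure X) (η : Measure Y) (π : X → Y) : Prop :=
  ∀ D : Kernel Y X, IsDisintegration ν η π D →
    ∀ᵐ y ∂η, ∀ B : Set X, MeasurableSet B → 0 < D y B →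
      ⨆ g : G, conjugated D g y B = 1

/-- The measure `∫ D₁(z) × D₂(z) dζ(z)` on `X × Y`; when `D₁` and `D₂` are the disintegrations
of `ν` and `η` over `ζ`, this is the independent relative joining of `(X, ν)` and `(Y, η)` over
`(Z, ζ)`. -/
noncomputable def independentRelativeJoining {X Y Z : Type*}
    [MeasurableSpace X] [MeasurableSpace Y] [MeasurableSpace Z]
    (ζ : Measure Z) (D₁ : Kernel Z X) (D₂ : Kernel Z Y) : Measure (X × Y) :=
  ζ.bind (fun z => (D₁ z).prod (D₂ z))

end GSpaces

/-! Let α = (ψ, τ) : W → X × Y. Two things are needed: α pushes ρ to the joining, and α is injective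
almost everywhere. Each says that an equivariant kernel is trivial, and each follows from
contractivity by pushing mass onto a bad set.

Joining: E(y) = ψ_* D_τ(y) is equivariant because τ is relatively measure-preserving, and its
barycenter over D_φ(z) is D_π(z) by uniqueness of disintegrations. If E(y)(A) ≥ q > D_π(z)(A) on a
set B of positive D_φ(z)-measure, some μ = g⁻¹D_φ(gz) has μ(B) close to 1. By equivariance of E and
D_π the barycenter over μ is still D_π(z), so D_π(z)(A) ≥ q μ(B), a contradiction. Hence E is
constant on fibers (`ae_ae_eq_of_bind_eq`), which is relative independence of ψ and τ.

Injectivity: let D disintegrate ρ over α_*ρ. As τ factors through α, the derivatives d(gρ)/dρ do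
too, and D is equivariant (`ae_equivariant_of_comp`). The kernel w ↦ D(α w) preserves the fiber
measures of ψ; contractivity forces D(α w) = δ_w (`ae_eq_dirac_of_bind_eq`), so α is invertible
almost everywhere.

The supremum over an uncountable G may see null sets. Averaging over a probability measure
equivalent to Haar measure therefore supplies versions that behave well along whole orbits. -/

namespace GSpaces

open scoped ENNReal

/-! ### Kernels and mixtures of measures -/

section Kernels

variable {α β : Type*} [MeasurableSpace α] [mβ : MeasurableSpace β]

/-- Countability lets "for every A, almost everywhere" become "almost everywhere, for every A";
closure under complements later turns one-sided bounds into equalities of probability measures. -/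
lemma exists_countable_isSetAlgebra_generateFrom (β : Type*) [mβ : MeasurableSpace β]
    [MeasurableSpace.CountablyGenerated β] :
    ∃ 𝒜 : Set (Set β), 𝒜.Countable ∧ IsSetAlgebra 𝒜 ∧ mβ = MeasurableSpace.generateFrom 𝒜 := by
  refine ⟨generateSetAlgebra (MeasurableSpace.countableGeneratingSet β),
    countable_generateSetAlgebra MeasurableSpace.countable_countableGeneratingSet,
    isSetAlgebra_generateSetAlgebra, ?_⟩
  rw [generateFrom_generateSetAlgebra_eq, MeasurableSpace.generateFrom_countableGeneratingSet]

lemma measure_ext_of_isSetAlgebra {𝒜 : Set (Set β)} (h𝒜 : IsSetAlgebra 𝒜)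
    (hgen : mβ = MeasurableSpace.generateFrom 𝒜) (μ ν : Measure β) [IsProbabilityMeasure μ]
    [IsProbabilityMeasure ν] (h : ∀ A ∈ 𝒜, μ A = ν A) : μ = ν :=
  ext_of_generate_finite 𝒜 hgen (fun _ hs _ ht _ => h𝒜.inter_mem hs ht) h (by simp)

lemma measurableSet_kernel_eq [MeasurableSpace.CountablyGenerated β] (κ κ' : Kernel α β)
    [IsMarkovKernel κ] [IsMarkovKernel κ'] : MeasurableSet {a | κ a = κ' a} := by
  obtain ⟨𝒜, hc, h𝒜, hgen⟩ := exists_countable_isSetAlgebra_generateFrom β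
  have : {a | κ a = κ' a} = ⋂ A ∈ 𝒜, {a | κ a A = κ' a A} := by
    ext a
    simp only [Set.mem_ofPred_eq, Set.mem_iInter]
    exact ⟨fun h A _ => by rw [h], measure_ext_of_isSetAlgebra h𝒜 hgen _ _⟩
  rw [this]
  refine MeasurableSet.biInter hc fun A hA => ?_
  have hA : MeasurableSet A := hgen ▸ MeasurableSpace.measurableSet_generateFrom hA
  exact measurableSet_eq_fun (κ.measurable_coe hA) (κ'.measurable_coe hA)

lemma isProbabilityMeasure_bind {m : Measure α} [IsProbabilityMeasure m] {κ : α → Measure β}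
    (hκ : Measurable κ) (h : ∀ a, IsProbabilityMeasure (κ a)) :
    IsProbabilityMeasure (m.bind κ) :=
  ⟨by rw [Measure.bind_apply .univ hκ.aemeasurable]; simp⟩

lemma bind_eq_of_ae_eq {m : Measure α} [IsProbabilityMeasure m] {κ : α → Measure β}
    {μ : Measure β} (h : ∀ᵐ a ∂m, κ a = μ) : m.bind κ = μ := by
  rw [Measure.bind_congr_right h, Measure.bind_const]
  simp

lemma ae_bind_iff {m : Measure α} {κ : α → Measure β} (hκ : Measurable κ) {s : Set β}
    (hs : MeasurableSet s) : (∀ᵐ b ∂m.bind κ, b ∈ s) ↔ ∀ᵐ a ∂m, ∀ᵐ b ∂κ a, b ∈ s := by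
  refine ⟨fun h => Measure.ae_ae_of_ae_bind hκ.aemeasurable h, fun h => ?_⟩
  rw [ae_iff]
  change m.bind κ sᶜ = 0
  rw [Measure.bind_apply hs.compl hκ.aemeasurable]
  exact (lintegral_eq_zero_iff ((Measure.measurable_coe hs.compl).comp hκ)).2 h

lemma map_bind {γ : Type*} [MeasurableSpace γ] {m : Measure α} {κ : α → Measure β}
    (hκ : Measurable κ) {f : β → γ} (hf : Measurable f) :
    (m.bind κ).map f = m.bind fun a => (κ a).map f := by
  ext s hs
  have hκ' : Measurable fun a => (κ a).map f := (Measure.measurable_map f hf).comp hκ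
  rw [Measure.map_apply hf hs, Measure.bind_apply (hf hs) hκ.aemeasurable,
    Measure.bind_apply hs hκ'.aemeasurable]
  simp_rw [Measure.map_apply hf hs]

lemma bind_map {γ : Type*} [MeasurableSpace γ] {m : Measure α} {f : α → β} (hf : Measurable f)
    {κ : β → Measure γ} (hκ : Measurable κ) : (m.map f).bind κ = m.bind fun a => κ (f a) := by
  ext s hs
  have hκ' : Measurable fun a => κ (f a) := hκ.comp hf
  rw [Measure.bind_apply hs hκ.aemeasurable, Measure.bind_apply hs hκ'.aemeasurable]
  exact lintegral_map ((Measure.measurable_coe hs).comp hκ) hf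

end Kernels

/-! ### Translates of measures -/

section Translate

variable {G X Y : Type*} [Group G] [MulAction G X] [MeasurableSpace X] [MeasurableSpace Y]

lemma translate_apply [MeasurableConstSMul G X] (g : G) (μ : Measure X) {s : Set X}
    (hs : MeasurableSet s) : translate g μ s = μ ((fun x => g • x) ⁻¹' s) :=
  Measure.map_apply (measurable_const_smul g) hs

lemma translate_translate [MeasurableConstSMul G X] (g h : G) (μ : Measure X) :
    translate g (translate h μ) = translate (g * h) μ := by
  unfold translate
  rw [Measure.map_map (measurable_const_smul g) (measurable_const_smul h)]
  congr 1
  ext x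
  simp [mul_smul]

lemma translate_one (μ : Measure X) : translate (1 : G) μ = μ := by
  simp [translate]

lemma translate_inv_translate [MeasurableConstSMul G X] (g : G) (μ : Measure X) :
    translate g⁻¹ (translate g μ) = μ := by
  rw [translate_translate, inv_mul_cancel, translate_one]

lemma isProbabilityMeasure_translate [MeasurableConstSMul G X] (g : G) (μ : Measure X)
    [IsProbabilityMeasure μ] : IsProbabilityMeasure (translate g μ) :=
  Measure.isProbabilityMeasure_map (measurable_const_smul g).aemeasurable

lemma ae_translate_iff [MeasurableConstSMul G X] (g : G) (μ : Measure X) {s : Set X}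
    (hs : MeasurableSet s) : (∀ᵐ x ∂translate g μ, x ∈ s) ↔ ∀ᵐ x ∂μ, g • x ∈ s :=
  ae_map_iff (measurable_const_smul g).aemeasurable hs

lemma translate_bind [MeasurableConstSMul G X] (g : G) {m : Measure Y} {κ : Y → Measure X}
    (hκ : Measurable κ) : translate g (m.bind κ) = m.bind fun y => translate g (κ y) :=
  map_bind hκ (measurable_const_smul g)

lemma bind_translate [MeasurableConstSMul G X] (g : G) {m : Measure X} {κ : X → Measure Y}
    (hκ : Measurable κ) : (translate g m).bind κ = m.bind fun x => κ (g • x) :=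
  bind_map (measurable_const_smul g) hκ

lemma IsGSpace.ae_smul {μ : Measure X} [MeasurableConstSMul G X] (hμ : IsGSpace G μ) (g : G)
    {p : X → Prop} (hp : ∀ᵐ x ∂μ, p x) : ∀ᵐ x ∂μ, p (g • x) :=
  ae_of_ae_map (measurable_const_smul g).aemeasurable
    ((hμ.translate_absolutelyContinuous g).ae_le hp)

end Translate

/-! ### Averaging over the group -/

section Averaging

/-- A probability measure with the null sets of Haar measure works, since right translations
preserve the Haar null class. -/
lemma exists_isProbabilityMeasure_quasiMeasurePreserving_mul_right (G : Type*) [Group G]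
    [TopologicalSpace G] [IsTopologicalGroup G] [LocallyCompactSpace G]
    [SecondCountableTopology G] [MeasurableSpace G] [BorelSpace G] :
    ∃ m : Measure G, IsProbabilityMeasure m ∧
      ∀ h : G, Measure.QuasiMeasurePreserving (fun g => g * h) m m := by
  refine ⟨(Measure.haar : Measure G).toFinite, inferInstance, fun h => ?_⟩
  refine ⟨measurable_mul_const h, ?_⟩
  have h1 := (quasiMeasurePreserving_mul_right (Measure.haar : Measure G) h).absolutelyContinuous
  exact ((toFinite_absolutelyContinuous _).map (measurable_mul_const h)).trans
    (h1.trans (absolutelyContinuous_toFinite _))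

variable {G Y P : Type*} [Group G] [MeasurableSpace G] [MulAction G Y] [MulAction G P]
  [MeasurableSpace Y] [MeasurableSpace P]

/-- The map `(g, y) ↦ g⁻¹ E(gy)` as a kernel. -/
noncomputable def conjugatedKernel [MeasurableInv G] [MeasurableSMul₂ G Y] [MeasurableSMul₂ G P]
    (E : Kernel Y P) [IsMarkovKernel E] : Kernel (G × Y) P where
  toFun q := conjugated E q.1 q.2
  measurable' := by
    refine Measure.measurable_of_measurable_coe _ fun s hs => ?_
    have hS : MeasurableSet {r : (G × Y) × P | r.1.1⁻¹ • r.2 ∈ s} :=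
      (measurable_fst.fst.inv.smul measurable_snd) hs
    let F : Kernel (G × Y) P := E.comap (fun q => q.1 • q.2) measurable_smul
    have : IsMarkovKernel F := ⟨fun q => inferInstanceAs (IsProbabilityMeasure (E (q.1 • q.2)))⟩
    have hF : (fun q : G × Y => conjugated E q.1 q.2 s) =
        fun q => F q (Prod.mk q ⁻¹' {r : (G × Y) × P | r.1.1⁻¹ • r.2 ∈ s}) := by
      ext q
      rw [conjugated, translate_apply _ _ hs]
      rfl
    rw [hF]
    exact Kernel.measurable_kernel_prodMk_left hS

variable [MeasurableInv G] [MeasurableSMul₂ G Y] [MeasurableSMul₂ G P]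

instance (E : Kernel Y P) [IsMarkovKernel E] : IsMarkovKernel (conjugatedKernel (G := G) E) :=
  ⟨fun q => isProbabilityMeasure_translate q.1⁻¹ (E (q.1 • q.2))⟩

lemma measurable_conjugated (E : Kernel Y P) [IsMarkovKernel E] (y : Y) :
    Measurable fun g : G => conjugated E g y :=
  (conjugatedKernel E).measurable.comp (measurable_id.prodMk measurable_const)

/-- The average of `g⁻¹ E(gy)` over `g`, as a kernel. -/
noncomputable def averagedKernel (m : Measure G) [IsProbabilityMeasure m]
    (E : Kernel Y P) [IsMarkovKernel E] : Kernel Y P where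
  toFun y := m.bind fun g => conjugated E g y
  measurable' := by
    refine Measure.measurable_of_measurable_coe _ fun s hs => ?_
    simp_rw [Measure.bind_apply hs (measurable_conjugated E _).aemeasurable]
    exact ((conjugatedKernel (G := G) E).measurable_coe hs).lintegral_prod_left'

instance (m : Measure G) [IsProbabilityMeasure m] (E : Kernel Y P) [IsMarkovKernel E] :
    IsMarkovKernel (averagedKernel m E) :=
  ⟨fun y => isProbabilityMeasure_bind (measurable_conjugated E y) fun g =>
    isProbabilityMeasure_translate g⁻¹ (E (g • y))⟩

/-- An almost everywhere equivariant kernel agrees almost everywhere with one that is strictly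
equivariant on an invariant conull set. -/
lemma exists_strictly_equivariant [MeasurableMul G] [MeasurableSpace.CountablyGenerated P]
    {m : Measure G} [IsProbabilityMeasure m]
    (hm : ∀ h : G, Measure.QuasiMeasurePreserving (fun g => g * h) m m)
    {η : Measure Y} [SFinite η] (E : Kernel Y P) [IsMarkovKernel E]
    (hE : ∀ g : G, ∀ᵐ y ∂η, E (g • y) = translate g (E y)) :
    ∃ (E' : Kernel Y P) (Y₀ : Set Y), IsMarkovKernel E' ∧ MeasurableSet Y₀ ∧
      (∀ᵐ y ∂η, y ∈ Y₀) ∧ (∀ᵐ y ∂η, E' y = E y) ∧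
      ∀ y ∈ Y₀, ∀ g : G, g • y ∈ Y₀ ∧ E' (g • y) = translate g (E' y) := by
  -- The good set consists of the y for which g ↦ g⁻¹E(gy) is m-almost everywhere constant; the
  -- constant is then the average E'(y). Fubini makes this set conull.
  let E' := averagedKernel m E
  let T := conjugatedKernel (G := G) E
  have hmeas (F : Kernel Y P) [IsMarkovKernel F] : MeasurableSet {q : G × Y | T q = F q.2} :=
    measurableSet_kernel_eq T (F.comap Prod.snd measurable_snd)
  have hE'_eq (y : Y) {μ : Measure P} (h : ∀ᵐ g ∂m, T (g, y) = μ) : E' y = μ := bind_eq_of_ae_eq h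
  have hae : ∀ᵐ y ∂η, ∀ᵐ g ∂m, T (g, y) = E y := by
    rw [Measure.ae_ae_comm (p := fun (y : Y) (g : G) => T (g, y) = E y)
      ((hmeas E).preimage measurable_swap)]
    refine .of_forall fun g => ?_
    filter_upwards [hE g] with y hy
    change translate g⁻¹ (E (g • y)) = E y
    rw [hy, translate_inv_translate]
  have hY₀ : MeasurableSet {y | ∀ᵐ g ∂m, T (g, y) = E' y} := by
    have h := measurable_measure_prodMk_right (μ := m) (hmeas E').compl
    exact h (measurableSet_singleton 0)
  refine ⟨E', {y | ∀ᵐ g ∂m, T (g, y) = E' y}, inferInstance, hY₀, ?_, ?_, fun y hy h => ?_⟩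
  · filter_upwards [hae] with y hy
    simpa [hE'_eq y hy] using hy
  · filter_upwards [hae] with y hy using hE'_eq y hy
  -- Replacing y by hy substitutes gh for g and translates by h; right quasi-invariance of m keeps
  -- the exceptional set null.
  · have key : ∀ᵐ g ∂m, T (g, h • y) = translate h (E' y) := by
      filter_upwards [(hm h).ae hy] with g hg
      rw [← hg]
      change translate g⁻¹ (E (g • h • y)) = translate h (translate (g * h)⁻¹ (E ((g * h) • y)))
      rw [translate_translate, mul_smul, mul_inv_rev, mul_inv_cancel_left]
    have h2 := hE'_eq _ key
    refine ⟨?_, h2⟩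
    simpa only [Set.mem_ofPred_eq, h2] using key

end Averaging

/-! ### Uniqueness of disintegrations -/

section Disintegration

variable {X Y : Type*} [MeasurableSpace X] [MeasurableSpace Y] {ν : Measure X} {η : Measure Y}
  {π : X → Y} {D D' : Kernel Y X}

lemma IsDisintegration.congr (hD : IsDisintegration ν η π D) [IsMarkovKernel D']
    (h : ∀ᵐ y ∂η, D' y = D y) : IsDisintegration ν η π D' where
  isMarkovKernel := inferInstance
  fiber := by filter_upwards [hD.fiber, h] with y h1 h2 using h2 ▸ h1
  bind_eq := by rw [← hD.bind_eq]; exact Measure.bind_congr_right h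

lemma IsDisintegration.ae_ae (hD : IsDisintegration ν η π D) {p : X → Prop}
    (hp : ∀ᵐ x ∂ν, p x) : ∀ᵐ y ∂η, ∀ᵐ x ∂D y, p x := by
  rw [← hD.bind_eq] at hp
  exact Measure.ae_ae_of_ae_bind D.measurable.aemeasurable hp

lemma IsDisintegration.ae_ae_fiber (hD : IsDisintegration ν η π D) :
    ∀ᵐ y ∂η, ∀ᵐ x ∂D y, π x = y := hD.fiber

lemma IsDisintegration.measure_inter_preimage (hD : IsDisintegration ν η π D)
    (hπ : Measurable π) {s : Set X} {t : Set Y} (hs : MeasurableSet s) (ht : MeasurableSet t) :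
    ν (s ∩ π ⁻¹' t) = ∫⁻ y in t, D y s ∂η := by
  rw [← hD.bind_eq, Measure.bind_apply (hs.inter (hπ ht)) D.measurable.aemeasurable,
    ← lintegral_indicator ht]
  refine lintegral_congr_ae ?_
  filter_upwards [hD.ae_ae_fiber] with y hy
  by_cases hyt : y ∈ t
  · rw [Set.indicator_of_mem hyt]
    refine measure_congr ?_
    filter_upwards [hy] with x hx
    refine propext ⟨fun h => h.1, fun h => ⟨h, ?_⟩⟩
    simpa [hx] using hyt
  · rw [Set.indicator_of_notMem hyt]
    change D y (s ∩ π ⁻¹' t) = 0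
    rw [measure_eq_zero_iff_ae_notMem]
    filter_upwards [hy] with x hx h
    exact hyt (by simpa [hx] using h.2)

lemma IsDisintegration.ae_eq [MeasurableSpace.CountablyGenerated X] [IsFiniteMeasure η]
    (hπ : Measurable π) (hD : IsDisintegration ν η π D) (hD' : IsDisintegration ν η π D') :
    ∀ᵐ y ∂η, D y = D' y := by
  have := hD.isMarkovKernel
  have := hD'.isMarkovKernel
  obtain ⟨𝒜, hc, h𝒜, hgen⟩ := exists_countable_isSetAlgebra_generateFrom X
  have hA : ∀ A ∈ 𝒜, ∀ᵐ y ∂η, D y A = D' y A := by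
    intro A hA
    have hA : MeasurableSet A := hgen ▸ MeasurableSpace.measurableSet_generateFrom hA
    refine ae_eq_of_forall_setLIntegral_eq_of_sigmaFinite (D.measurable_coe hA)
      (D'.measurable_coe hA) fun t ht _ => ?_
    rw [← hD.measure_inter_preimage hπ hA ht, ← hD'.measure_inter_preimage hπ hA ht]
  filter_upwards [(ae_ball_iff hc).2 hA] with y hy
  exact measure_ext_of_isSetAlgebra h𝒜 hgen _ _ hy

end Disintegration

/-! ### Rigidity of equivariant kernels under contractive maps -/

section Contractive

variable {G Y Z P : Type*} [Group G] [MeasurableSpace G] [MeasurableInv G]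
  [MulAction G Y] [MeasurableSpace Y] [MeasurableSMul₂ G Y]
  [MulAction G Z] [MeasurableSpace Z] [MeasurableSMul₂ G Z]
  [MulAction G P] [MeasurableSpace P] [MeasurableSMul₂ G P]
  [MeasurableSpace.CountablyGenerated P]
  {η : Measure Y} {ζ : Measure Z} {φ : Y → Z} {D : Kernel Z Y}

/-- If the disintegration of a relatively contractive map satisfies almost everywhere a condition
that is invariant and stable under averaging, then the measures satisfying this condition at a
point `z` nearly concentrate on every set that is not null for the disintegration at `z`. -/
lemma IsRelContractive.ae_exists_lt {m : Measure G} [IsProbabilityMeasure m]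
    (hm : ∀ h : G, Measure.QuasiMeasurePreserving (fun g => g * h) m m)
    (hζ : IsGSpace G ζ) (hφ : IsRelContractive G η ζ φ) (hD : IsDisintegration η ζ φ D)
    {Q : Z → Measure Y → Prop} (hQ : ∀ᵐ z ∂ζ, Q z (D z))
    (hQ_translate : ∀ (z : Z) (g : G) (μ : Measure Y), Q (g • z) μ → Q z (translate g⁻¹ μ))
    (hQ_bind : ∀ (z : Z) (κ : G → Measure Y), Measurable κ → (∀ᵐ g ∂m, Q z (κ g)) →
      Q z (m.bind κ)) :
    ∀ᵐ z ∂ζ, ∀ B : Set Y, MeasurableSet B → 0 < D z B → ∀ δ < 1,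
      ∃ μ : Measure Y, IsProbabilityMeasure μ ∧ Q z μ ∧ δ < μ B := by
  classical
  have := hD.isMarkovKernel
  have := hζ.isProbabilityMeasure
  obtain ⟨Z₁, hZ₁_ae, hZ₁, hZ₁_sub⟩ := hQ.exists_measurable_mem
  -- Unlike Z₁, this conull set is invariant, so a supremum over all g never leaves it.
  let Z₂ : Set Z := {z | ∀ᵐ g ∂m, g • z ∈ Z₁}
  have hsmul : MeasurableSet {q : G × Z | q.1 • q.2 ∈ Z₁} := measurable_smul hZ₁
  have hZ₂ : ∀ᵐ z ∂ζ, z ∈ Z₂ := by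
    change ∀ᵐ z ∂ζ, ∀ᵐ g ∂m, g • z ∈ Z₁
    rw [Measure.ae_ae_comm (p := fun (z : Z) (g : G) => g • z ∈ Z₁)
      (hsmul.preimage measurable_swap)]
    exact .of_forall fun g => hζ.ae_smul g hZ₁_ae
  have hZ₂_smul (z : Z) (hz : z ∈ Z₂) (h : G) : h • z ∈ Z₂ := by
    filter_upwards [(hm h).ae hz] with g hg
    rwa [smul_smul]
  -- Off Z₁ the value is replaced by the average of g⁻¹D(gz), which satisfies Q for every z in Z₂.
  -- Contractivity is then applied to this version.
  let D' : Kernel Z Y := Kernel.piecewise hZ₁ D (averagedKernel m D)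
  have hD'D : ∀ᵐ z ∂ζ, D' z = D z := by
    filter_upwards [hZ₁_ae] with z hz
    simp [D', Kernel.piecewise_apply, hz]
  have hD' : IsDisintegration η ζ φ D' := hD.congr hD'D
  have hQ' (z : Z) (hz : z ∈ Z₂) : Q z (D' z) := by
    by_cases hz₁ : z ∈ Z₁
    · simpa [D', Kernel.piecewise_apply, hz₁] using hZ₁_sub z hz₁
    · simp only [D', Kernel.piecewise_apply, hz₁, if_false]
      refine hQ_bind z _ (measurable_conjugated D z) ?_
      filter_upwards [hz] with g hg
      exact hQ_translate z g _ (hZ₁_sub _ hg)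
  filter_upwards [hφ D' hD', hD'D, hZ₂] with z hz hDz hz₂ B hB hDB δ hδ
  rw [← hz B hB (hDz ▸ hDB), lt_iSup_iff] at hδ
  obtain ⟨g, hg⟩ := hδ
  have : IsMarkovKernel D' := hD'.isMarkovKernel
  exact ⟨_, isProbabilityMeasure_translate g⁻¹ (D' (g • z)),
    hQ_translate z g _ (hQ' _ (hZ₂_smul z hz₂ g)), hg⟩

/-- An equivariant kernel on the source of a relatively contractive map whose barycenter over the
target is equivariant is constant on almost every fiber. -/
lemma IsRelContractive.ae_ae_eq_of_bind_eq [MeasurableMul G] {m : Measure G} [IsProbabilityMeasure m]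
    (hm : ∀ h : G, Measure.QuasiMeasurePreserving (fun g => g * h) m m)
    (hη : IsGSpace G η) (hζ : IsGSpace G ζ) (hφ : IsRelContractive G η ζ φ)
    (hD : IsDisintegration η ζ φ D) (E : Kernel Y P) (K : Kernel Z P)
    [IsMarkovKernel E] [IsMarkovKernel K]
    (hE : ∀ g : G, ∀ᵐ y ∂η, E (g • y) = translate g (E y))
    (hK : ∀ g : G, ∀ᵐ z ∂ζ, K (g • z) = translate g (K z))
    (hEK : ∀ᵐ z ∂ζ, (D z).bind E = K z) :
    ∀ᵐ z ∂ζ, ∀ᵐ y ∂D z, E y = K z := by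
  have := hD.isMarkovKernel
  have := hη.isProbabilityMeasure
  have := hζ.isProbabilityMeasure
  obtain ⟨E', Y₀, hE'm, hY₀, hY₀_ae, hE'E, hE'⟩ := exists_strictly_equivariant hm E hE
  obtain ⟨K', Z₀, hK'm, hZ₀, hZ₀_ae, hK'K, hK'⟩ := exists_strictly_equivariant hm K hK
  -- "μ has barycenter K'(z)". The premise z ∈ Z₀ makes the stability conditions hold at every z, as
  -- Z₀ is invariant.
  let Q : Z → Measure Y → Prop := fun z μ => z ∈ Z₀ → (∀ᵐ y ∂μ, y ∈ Y₀) ∧ μ.bind E' = K' z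
  have hQ : ∀ᵐ z ∂ζ, Q z (D z) := by
    filter_upwards [hD.ae_ae hY₀_ae, hD.ae_ae hE'E, hEK, hK'K] with z h1 h2 h3 h4 _
    exact ⟨h1, by rw [h4, ← h3]; exact Measure.bind_congr_right h2⟩
  have key := hφ.ae_exists_lt hm hζ hD hQ ?_ ?_
  rotate_left
  · intro z g μ h hz
    obtain ⟨h1, h2⟩ := h (hK' z hz g).1
    refine ⟨(ae_translate_iff _ _ hY₀).2 (h1.mono fun y hy => (hE' y hy _).1), ?_⟩
    rw [bind_translate _ E'.measurable,
      Measure.bind_congr_right (h1.mono fun y hy => (hE' y hy g⁻¹).2),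
      ← translate_bind _ E'.measurable, h2, (hK' z hz g).2, translate_inv_translate]
  · intro z κ hκ h hz
    refine ⟨(ae_bind_iff hκ hY₀).2 (h.mono fun g hg => (hg hz).1), ?_⟩
    rw [Measure.bind_bind hκ.aemeasurable E'.measurable.aemeasurable]
    exact bind_eq_of_ae_eq (h.mono fun g hg => (hg hz).2)
  obtain ⟨𝒜, hc, h𝒜, hgen⟩ := exists_countable_isSetAlgebra_generateFrom P
  filter_upwards [key, hQ, hZ₀_ae, hK'K, hD.ae_ae hE'E] with z hz hQz hz₀ hKz hEz
  have hle : ∀ A ∈ 𝒜, ∀ᵐ y ∂D z, E' y A ≤ K' z A := by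
    intro A hA
    have hA : MeasurableSet A := hgen ▸ MeasurableSpace.measurableSet_generateFrom hA
    have hc : ∀ q : ℚ, K' z A < (Real.toNNReal q : ℝ≥0∞) →
        ∀ᵐ y ∂D z, E' y A < (Real.toNNReal q : ℝ≥0∞) := by
      intro q hq
      have hB : MeasurableSet {y | (Real.toNNReal q : ℝ≥0∞) ≤ E' y A} :=
        measurableSet_le measurable_const (E'.measurable_coe hA)
      by_contra hne
      simp only [ae_iff, not_lt] at hne
      have hq0 : (Real.toNNReal q : ℝ≥0∞) ≠ 0 := (zero_le.trans_lt hq).ne'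
      -- The threshold K'(z)(A)/q is below 1, and exceeding it contradicts Markov's inequality q
      -- μ(B) ≤ ∫ E'(y)(A) dμ = K'(z)(A).
      obtain ⟨μ, hμ, hQμ, hlt⟩ := hz _ hB (pos_iff_ne_zero.2 hne)
        (K' z A / (Real.toNNReal q : ℝ≥0∞))
        ((ENNReal.div_lt_iff (.inl hq0) (.inl ENNReal.coe_ne_top)).2 (by rwa [one_mul]))
      rw [ENNReal.div_lt_iff (.inl hq0) (.inl ENNReal.coe_ne_top), mul_comm] at hlt
      refine hlt.not_ge ?_
      rw [← (hQμ hz₀).2, Measure.bind_apply hA E'.measurable.aemeasurable]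
      exact mul_meas_ge_le_lintegral (E'.measurable_coe hA) _
    filter_upwards [ae_all_iff.2 fun q => Filter.eventually_imp_distrib_left.2 (hc q)] with y hy
    by_contra! h
    obtain ⟨q, -, h1, h2⟩ := ENNReal.lt_iff_exists_rat_btwn.1 h
    exact (hy q h1).not_gt h2
  have hle' : ∀ᵐ y ∂D z, ∀ A ∈ 𝒜, E' y A ≤ K' z A := (ae_ball_iff hc).2 hle
  filter_upwards [hle', hEz] with y hy hEy
  rw [← hEy, ← hKz]
  refine measure_ext_of_isSetAlgebra h𝒜 hgen _ _ fun A hA => le_antisymm (hy A hA) ?_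
  have hAm : MeasurableSet A := hgen ▸ MeasurableSpace.measurableSet_generateFrom hA
  have h1 := hy Aᶜ (h𝒜.compl_mem hA)
  rw [prob_compl_eq_one_sub hAm, prob_compl_eq_one_sub hAm] at h1
  exact (ENNReal.sub_le_sub_iff_left prob_le_one ENNReal.one_ne_top).1 h1

/-- An equivariant kernel on the source of a relatively contractive map that preserves almost
every fiber measure is the identity kernel. -/
lemma IsRelContractive.ae_eq_dirac_of_bind_eq [MeasurableMul G] [MeasurableSpace.CountablyGenerated Y]
    {m : Measure G} [IsProbabilityMeasure m]
    (hm : ∀ h : G, Measure.QuasiMeasurePreserving (fun g => g * h) m m)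
    (hη : IsGSpace G η) (hζ : IsGSpace G ζ) (hφ : IsRelContractive G η ζ φ)
    (hD : IsDisintegration η ζ φ D) (E : Kernel Y Y) [IsMarkovKernel E]
    (hE : ∀ g : G, ∀ᵐ y ∂η, E (g • y) = translate g (E y))
    (hED : ∀ᵐ z ∂ζ, (D z).bind E = D z) :
    ∀ᵐ y ∂η, E y = Measure.dirac y := by
  have := hD.isMarkovKernel
  have := hη.isProbabilityMeasure
  have := hζ.isProbabilityMeasure
  obtain ⟨E', Y₀, hE'm, hY₀, hY₀_ae, hE'E, hE'⟩ := exists_strictly_equivariant hm E hE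
  let Q : Z → Measure Y → Prop := fun _ μ => (∀ᵐ y ∂μ, y ∈ Y₀) ∧ μ.bind E' = μ
  have hQ : ∀ᵐ z ∂ζ, Q z (D z) := by
    filter_upwards [hD.ae_ae hY₀_ae, hD.ae_ae hE'E, hED] with z h1 h2 h3
    exact ⟨h1, (Measure.bind_congr_right h2).trans h3⟩
  have key := hφ.ae_exists_lt hm hζ hD hQ ?_ ?_
  rotate_left
  · rintro z g μ ⟨h1, h2⟩
    refine ⟨(ae_translate_iff _ _ hY₀).2 (h1.mono fun y hy => (hE' y hy _).1), ?_⟩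
    rw [bind_translate _ E'.measurable,
      Measure.bind_congr_right (h1.mono fun y hy => (hE' y hy g⁻¹).2),
      ← translate_bind _ E'.measurable, h2]
  · intro z κ hκ h
    refine ⟨(ae_bind_iff hκ hY₀).2 (h.mono fun g hg => hg.1), ?_⟩
    rw [Measure.bind_bind hκ.aemeasurable E'.measurable.aemeasurable]
    exact Measure.bind_congr_right (h.mono fun g hg => hg.2)
  obtain ⟨𝒜, hc, h𝒜, hgen⟩ := exists_countable_isSetAlgebra_generateFrom Y
  have hone : ∀ A ∈ 𝒜, ∀ᵐ y ∂η, y ∈ A → E' y A = 1 := by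
    intro A hA
    have hA : MeasurableSet A := hgen ▸ MeasurableSpace.measurableSet_generateFrom hA
    have hAE : MeasurableSet {y | y ∈ A → E' y A = 1} :=
      (hA.mem.imp ((E'.measurable_coe hA).eq measurable_const)).setOf
    rw [← hD.bind_eq]
    refine (ae_bind_iff D.measurable hAE).2 ?_
    filter_upwards [key] with z hz
    have hq : ∀ q : ℚ, (Real.toNNReal q : ℝ≥0∞) < 1 →
        ∀ᵐ y ∂D z, y ∈ A → (Real.toNNReal q : ℝ≥0∞) < E' y A := by
      intro q hq
      set c := Real.toNNReal q
      set B := {y | y ∈ A ∧ E' y A ≤ c}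
      have hB : MeasurableSet B :=
        hA.inter (measurableSet_le (E'.measurable_coe hA) measurable_const)
      by_contra hne
      simp only [ae_iff, Classical.not_imp, not_lt] at hne
      have hc : (c : ℝ) < 1 := by exact_mod_cast hq
      -- Invariance of μ under E' yields μ(B) ≤ cμ(B) + 1 - μ(B), that is μ(B) ≤ 1/(2 - c), which is
      -- less than 1 because c < 1.
      obtain ⟨μ, hμ, ⟨-, hQμ⟩, hlt⟩ := hz B hB (pos_iff_ne_zero.2 hne)
        (ENNReal.ofReal (1 / (2 - c))) (by
          rw [← ENNReal.ofReal_one, ENNReal.ofReal_lt_ofReal_iff one_pos,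
            div_lt_one (by linarith)]
          linarith)
      have hle : μ B ≤ c * μ B + μ Bᶜ := calc
        μ B ≤ μ A := measure_mono fun y hy => hy.1
        _ = ∫⁻ y, E' y A ∂μ := by
          conv_lhs => rw [← hQμ]
          exact Measure.bind_apply hA E'.measurable.aemeasurable
        _ = ∫⁻ y in B, E' y A ∂μ + ∫⁻ y in Bᶜ, E' y A ∂μ := (lintegral_add_compl _ hB).symm
        _ ≤ ∫⁻ _ in B, c ∂μ + ∫⁻ _ in Bᶜ, 1 ∂μ :=
          add_le_add (setLIntegral_mono' hB fun y hy => hy.2)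
            (lintegral_mono fun y => prob_le_one)
        _ = c * μ B + μ Bᶜ := by simp
      have hle' : μ.real B ≤ c * μ.real B + (1 - μ.real B) := by
        rw [← probReal_compl_eq_one_sub hB]
        have := ENNReal.toReal_mono (by finiteness) hle
        rwa [ENNReal.toReal_add (by finiteness) (by finiteness), ENNReal.toReal_mul] at this
      have hlt' : 1 / (2 - c) < μ.real B :=
        (ENNReal.ofReal_lt_iff_lt_toReal (by rw [one_div_nonneg]; linarith) (by finiteness)).1 hlt
      rw [div_lt_iff₀ (by linarith)] at hlt'
      linarith
    filter_upwards [ae_all_iff.2 fun q => Filter.eventually_imp_distrib_left.2 (hq q)] with y hy hyA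
    refine le_antisymm prob_le_one ?_
    by_contra! h
    obtain ⟨q, -, h1, h2⟩ := ENNReal.lt_iff_exists_rat_btwn.1 h
    exact (hy q h2 hyA).not_gt h1
  have hone' : ∀ᵐ y ∂η, ∀ A ∈ 𝒜, y ∈ A → E' y A = 1 := (ae_ball_iff hc).2 hone
  filter_upwards [hone', hE'E] with y hy hEy
  rw [← hEy]
  refine measure_ext_of_isSetAlgebra h𝒜 hgen _ _ fun A hA => ?_
  have hAm : MeasurableSet A := hgen ▸ MeasurableSpace.measurableSet_generateFrom hA
  by_cases hyA : y ∈ A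
  · rw [hy A hA hyA, Measure.dirac_apply' _ hAm, Set.indicator_of_mem hyA, Pi.one_apply]
  · rw [Measure.dirac_apply' _ hAm, Set.indicator_of_notMem hyA, ← prob_compl_eq_one_iff hAm]
    exact hy Aᶜ (h𝒜.compl_mem hA) hyA

end Contractive

/-! ### Densities, composition and inverses of maps -/

section Disintegration

variable {X Y Z : Type*} [MeasurableSpace X] [MeasurableSpace Y] [MeasurableSpace Z]

lemma map_withDensity_comp {μ : Measure X} {f : X → Y} (hf : Measurable f) {h : Y → ℝ≥0∞}
    (hh : Measurable h) : (μ.withDensity (h ∘ f)).map f = (μ.map f).withDensity h := by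
  ext s hs
  rw [Measure.map_apply hf hs, withDensity_apply _ (hf hs), withDensity_apply _ hs,
    setLIntegral_map hs hh hf]
  rfl

/-- A density pulled back from the base is constant on fibers, so reweighting leaves the fiber
measures unchanged. -/
lemma IsDisintegration.withDensity_bind {ν : Measure X} {η : Measure Y} {π : X → Y}
    {D : Kernel Y X} (hD : IsDisintegration ν η π D) (hπ : Measurable π) {h : Y → ℝ≥0∞}
    (hh : Measurable h) : (η.withDensity h).bind D = ν.withDensity (h ∘ π) := by
  ext s hs
  rw [withDensity_apply _ hs, ← lintegral_indicator hs, ← hD.bind_eq,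
    Measure.lintegral_bind D.measurable.aemeasurable ((hh.comp hπ).indicator hs).aemeasurable,
    Measure.bind_apply hs D.measurable.aemeasurable,
    lintegral_withDensity_eq_lintegral_mul _ hh (D.measurable_coe hs)]
  refine lintegral_congr_ae ?_
  filter_upwards [hD.ae_ae_fiber] with y hy
  rw [lintegral_indicator hs, setLIntegral_congr_fun_ae (g := fun _ => h y) hs]
  · simp
  · filter_upwards [hy] with x hx _
    simp [hx]

lemma IsDisintegration.comp [MeasurableSingletonClass Z] {ν : Measure X} {η : Measure Y}
    {ζ : Measure Z} {φ : Y → Z} {D : Kernel Z Y} (hD : IsDisintegration η ζ φ D)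
    {E : Kernel Y X} [IsMarkovKernel E] {π : X → Z} (hπ : Measurable π)
    (hE : ∀ᵐ y ∂η, ∀ᵐ x ∂E y, π x = φ y) (hν : η.bind E = ν) :
    IsDisintegration ν ζ π (E ∘ₖ D) where
  isMarkovKernel := have := hD.isMarkovKernel; inferInstance
  fiber := by
    filter_upwards [hD.ae_ae_fiber, hD.ae_ae hE] with z h1 h2
    rw [Kernel.comp_apply]
    refine (ae_bind_iff E.measurable (hπ (measurableSet_singleton z))).2 ?_
    filter_upwards [h1, h2] with y h3 h4
    filter_upwards [h4] with x hx
    exact hx.trans h3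
  bind_eq := by
    rw [← hν, ← hD.bind_eq, Measure.bind_bind D.measurable.aemeasurable
      E.measurable.aemeasurable]
    simp_rw [← Kernel.comp_apply]

/-- If the disintegration over the image of a map consists of point masses, then the map has a
measurable left inverse almost everywhere. -/
lemma exists_measurable_ae_leftInverse [StandardBorelSpace X]
    [MeasurableSpace.CountablySeparated Y] {ν : Measure X} [NeZero ν] {f : X → Y}
    (hf : Measurable f) {D : Y → Measure X} (hD : ∀ᵐ x ∂ν, D (f x) = Measure.dirac x) :
    ∃ h : Y → X, Measurable h ∧ ∀ᵐ x ∂ν, h (f x) = x := by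
  obtain ⟨S, hS_ae, hS, hSD⟩ := hD.exists_measurable_mem
  have := hS.standardBorel
  -- The point mass at x is recovered from f(x), so f is injective on S; a measurable injection
  -- between such spaces is a measurable embedding (Lusin–Souslin).
  have hinj : Function.Injective fun x : S => f x := by
    intro x x' hxx
    have h : Measure.dirac x.1 = Measure.dirac x'.1 := by
      rw [← hSD _ x.2, ← hSD _ x'.2]
      exact congrArg D hxx
    exact Subtype.ext (dirac_eq_dirac_iff.1 h)
  have hemb := (hf.comp measurable_subtype_coe).measurableEmbedding hinj
  have hne : Nonempty X := ν.nonempty_of_neZero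
  obtain ⟨h, hh, heq⟩ := hemb.exists_measurable_extend (measurable_subtype_coe (p := (· ∈ S)))
    fun _ => hne
  refine ⟨h, hh, ?_⟩
  filter_upwards [hS_ae] with x hx
  exact congrFun heq ⟨x, hx⟩

end Disintegration

/-! ### Equivariance of disintegrations over intermediate factors -/

section Equivariance

variable {G W V Y : Type*} [Group G] [MulAction G W] [MulAction G V] [MulAction G Y]
  [MeasurableSpace W] [MeasurableSpace V] [MeasurableSpace Y]
  [MeasurableConstSMul G W] [MeasurableConstSMul G V] [MeasurableConstSMul G Y]
  {ρ : Measure W} {μ : Measure V} {η : Measure Y}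

lemma IsGMap.map_translate {α : W → V} (hα : IsGMap G ρ μ α) (g : G) :
    (translate g ρ).map α = translate g μ := by
  rw [← hα.map_eq, translate, translate, Measure.map_map hα.measurable (measurable_const_smul g),
    Measure.map_map (measurable_const_smul g) hα.measurable]
  exact Measure.map_congr (hα.equivariant g)

lemma IsGMap.isGSpace {α : W → V} (hα : IsGMap G ρ μ α) (hρ : IsGSpace G ρ) :
    IsGSpace G μ where
  isProbabilityMeasure := by
    have := hρ.isProbabilityMeasure
    rw [← hα.map_eq]
    exact Measure.isProbabilityMeasure_map hα.measurable.aemeasurable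
  translate_absolutelyContinuous g := by
    rw [← hα.map_translate g, ← hα.map_eq]
    exact (hρ.translate_absolutelyContinuous g).map hα.measurable
  absolutelyContinuous_translate g := by
    rw [← hα.map_translate g, ← hα.map_eq]
    exact (hρ.absolutelyContinuous_translate g).map hα.measurable

/-- A relatively measure-preserving map has Radon-Nikodym derivatives that factor through it. -/
lemma IsRelMeasurePreserving.exists_translate_eq_withDensity {τ : W → Y} {D : Kernel Y W}
    (hη : IsGSpace G η) (hτ : Measurable τ) (hmp : IsRelMeasurePreserving G ρ η τ)
    (hD : IsDisintegration ρ η τ D) (g : G) :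
    ∃ h : Y → ℝ≥0∞, Measurable h ∧ translate g ρ = ρ.withDensity (h ∘ τ) := by
  have := hη.isProbabilityMeasure
  have : IsProbabilityMeasure (translate g η) := isProbabilityMeasure_translate g η
  refine ⟨(translate g η).rnDeriv η, Measure.measurable_rnDeriv _ _, ?_⟩
  -- The computation is gρ = ∫ gD(y) dη = ∫ D(gy) dη = ∫ D d(gη), with gη = h·η.
  rw [← hD.withDensity_bind hτ (Measure.measurable_rnDeriv _ _),
    Measure.withDensity_rnDeriv_eq _ _ (hη.translate_absolutelyContinuous g),
    bind_translate g D.measurable, Measure.bind_congr_right (hmp D hD g),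
    ← translate_bind g D.measurable, hD.bind_eq]

/-- If a relatively measure-preserving map factors through a `G`-map, then the disintegration over
the latter is equivariant. -/
lemma IsRelMeasurePreserving.ae_equivariant_of_comp [StandardBorelSpace W]
    [MeasurableSingletonClass V] {α : W → V}
    {p : V → Y} {D : Kernel V W} {Dτ : Kernel Y W} (hρ : IsGSpace G ρ) (hη : IsGSpace G η)
    (hα : IsGMap G ρ μ α) (hp : Measurable p) (hmp : IsRelMeasurePreserving G ρ η (p ∘ α))
    (hDτ : IsDisintegration ρ η (p ∘ α) Dτ) (hD : IsDisintegration ρ μ α D) (g : G) :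
    ∀ᵐ v ∂μ, D (g • v) = translate g (D v) := by
  have := hD.isMarkovKernel
  have hμ := hα.isGSpace hρ
  have := hμ.isProbabilityMeasure
  have : IsProbabilityMeasure (translate g μ) := isProbabilityMeasure_translate g μ
  obtain ⟨h, hh, hgρ⟩ :=
    hmp.exists_translate_eq_withDensity hη (hp.comp hα.measurable) hDτ g
  have hgμ : translate g μ = μ.withDensity (h ∘ p) := by
    rw [← hα.map_translate g, hgρ, ← Function.comp_assoc,
      map_withDensity_comp hα.measurable (hh.comp hp), hα.map_eq]
  -- Both D and v ↦ gD(g⁻¹v) disintegrate gρ over gμ: the first because the density of gρ factors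
  -- through α, the second by transport. Uniqueness identifies them.
  have h1 : IsDisintegration (translate g ρ) (translate g μ) α D := by
    refine ⟨inferInstance, (hμ.translate_absolutelyContinuous g).ae_le hD.fiber, ?_⟩
    rw [hgμ, hD.withDensity_bind hα.measurable (hh.comp hp), hgρ, Function.comp_assoc]
  let K : Kernel V W := (D.comap (g⁻¹ • ·) (measurable_const_smul g⁻¹)).map (g • ·)
  have hK (v : V) : K v = translate g (D (g⁻¹ • v)) :=
    Kernel.map_apply _ (measurable_const_smul g) v
  have hKm : IsMarkovKernel K :=
    ⟨fun v => by rw [hK]; exact isProbabilityMeasure_translate g _⟩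
  have h2 : IsDisintegration (translate g ρ) (translate g μ) α K := by
    refine ⟨hKm, ?_, ?_⟩
    · have hinv : ∀ᵐ v ∂translate g μ, ∀ᵐ w ∂D (g⁻¹ • v), α (g • w) = v := by
        have hA : ∀ᵐ v ∂μ, ∀ᵐ w ∂D v, α (g • w) = g • v := by
          filter_upwards [hD.ae_ae (hα.equivariant g), hD.ae_ae_fiber] with v h3 h4
          filter_upwards [h3, h4] with w h5 h6
          rw [h5, h6]
        have hB := (hμ.translate_absolutelyContinuous g).ae_le (hμ.ae_smul g⁻¹ hA)
        filter_upwards [hB] with v hv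
        simpa using hv
      filter_upwards [hinv] with v hv
      rw [hK]
      exact (ae_translate_iff g _ (hα.measurable (measurableSet_singleton v))).2 hv
    · rw [bind_translate g K.measurable, ← hD.bind_eq, translate_bind g D.measurable]
      simp_rw [hK, inv_smul_smul]
  have h3 := ae_of_ae_map (measurable_const_smul g).aemeasurable (h1.ae_eq hα.measurable h2)
  filter_upwards [h3] with v hv
  rw [hv, hK, inv_smul_smul]

end Equivariance

/-! ### The relatively independent joining -/

section Joining

variable {W X Y Z : Type*} [MeasurableSpace W] [MeasurableSpace X] [MeasurableSpace Y]
  [MeasurableSpace Z]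

lemma measurable_prod_kernel (D₁ : Kernel Z X) (D₂ : Kernel Z Y) [IsMarkovKernel D₁]
    [IsMarkovKernel D₂] : Measurable fun z => (D₁ z).prod (D₂ z) := by
  simp_rw [← Kernel.prod_apply]
  exact (D₁ ×ₖ D₂).measurable

/-- Relative independence: if the push-forwards of the fiber measures of `τ` are the fiber measures
of `π`, then `(ψ, τ)` has the independent relative joining as its distribution. -/
lemma map_prodMk_eq_independentRelativeJoining {ρ : Measure W} {η : Measure Y} {ζ : Measure Z}
    [IsProbabilityMeasure ρ]
    {ψ : W → X} {τ : W → Y} {φ : Y → Z} (hψ : Measurable ψ) (hτ : Measurable τ)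
    {Dτ : Kernel Y W} {Dφ : Kernel Z Y} {Dπ : Kernel Z X} [IsMarkovKernel Dπ]
    (hDτ : IsDisintegration ρ η τ Dτ) (hDφ : IsDisintegration η ζ φ Dφ)
    (h : ∀ᵐ z ∂ζ, ∀ᵐ y ∂Dφ z, (Dτ y).map ψ = Dπ z) :
    ρ.map (fun w => (ψ w, τ w)) = independentRelativeJoining ζ Dπ Dφ := by
  have := hDφ.isMarkovKernel
  have hm : Measurable fun w => (ψ w, τ w) := hψ.prodMk hτ
  have := Measure.isProbabilityMeasure_map (μ := ρ) hm.aemeasurable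
  refine Measure.ext_prod fun {s t} hs ht => ?_
  rw [Measure.map_apply hm (hs.prod ht), independentRelativeJoining,
    Measure.bind_apply (hs.prod ht) (measurable_prod_kernel Dπ Dφ).aemeasurable]
  have hpre : (fun w => (ψ w, τ w)) ⁻¹' (s ×ˢ t) = ψ ⁻¹' s ∩ τ ⁻¹' t := rfl
  have hmeas : Measurable (t.indicator fun y => Dτ y (ψ ⁻¹' s)) :=
    (Dτ.measurable_coe (hψ hs)).indicator ht
  rw [hpre, hDτ.measure_inter_preimage hτ (hψ hs) ht, ← lintegral_indicator ht, ← hDφ.bind_eq,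
    Measure.lintegral_bind Dφ.measurable.aemeasurable hmeas.aemeasurable]
  refine lintegral_congr_ae ?_
  filter_upwards [h] with z hz
  rw [Measure.prod_prod, lintegral_indicator ht,
    setLIntegral_congr_fun_ae (g := fun _ => Dπ z s) ht]
  · simp
  · filter_upwards [hz] with y hy _
    rw [← hy, Measure.map_apply hψ hs]

end Joining

end GSpaces

/-! ### The corollary -/

theorem corollaryC {G : Type*} [Group G] [TopologicalSpace G] [IsTopologicalGroup G]
    [LocallyCompactSpace G] [SecondCountableTopology G] [MeasurableSpace G] [BorelSpace G]
    {W X Y Z : Type*}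
    [MeasurableSpace W] [StandardBorelSpace W] [MulAction G W] [MeasurableSMul₂ G W]
    [MeasurableSpace X] [StandardBorelSpace X] [MulAction G X] [MeasurableSMul₂ G X]
    [MeasurableSpace Y] [StandardBorelSpace Y] [MulAction G Y] [MeasurableSMul₂ G Y]
    [MeasurableSpace Z] [StandardBorelSpace Z] [MulAction G Z] [MeasurableSMul₂ G Z]
    (ρ : Measure W) (ν : Measure X) (η : Measure Y) (ζ : Measure Z)
    (hW : GSpaces.IsGSpace G ρ) (hX : GSpaces.IsGSpace G ν)
    (hY : GSpaces.IsGSpace G η) (hZ : GSpaces.IsGSpace G ζ)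
    (ψ : W → X) (τ : W → Y) (π : X → Z) (φ : Y → Z)
    (hψ : GSpaces.IsGMap G ρ ν ψ) (hτ : GSpaces.IsGMap G ρ η τ)
    (hπ : GSpaces.IsGMap G ν ζ π) (hφ : GSpaces.IsGMap G η ζ φ)
    (hcomm : ∀ᵐ w ∂ρ, π (ψ w) = φ (τ w))
    (hτ_mp : GSpaces.IsRelMeasurePreserving G ρ η τ)
    (hπ_mp : GSpaces.IsRelMeasurePreserving G ν ζ π)
    (hψ_contr : GSpaces.IsRelContractive G ρ ν ψ)
    (hφ_contr : GSpaces.IsRelContractive G η ζ φ)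
    (Dπ : Kernel Z X) (Dφ : Kernel Z Y)
    (hDπ : GSpaces.IsDisintegration ν ζ π Dπ) (hDφ : GSpaces.IsDisintegration η ζ φ Dφ) :
    GSpaces.IsGSpace G (GSpaces.independentRelativeJoining ζ Dπ Dφ) ∧
      GSpaces.GIsomorphic G ρ (GSpaces.independentRelativeJoining ζ Dπ Dφ) := by
  have := hW.isProbabilityMeasure
  have := hX.isProbabilityMeasure
  have := hZ.isProbabilityMeasure
  have := hDπ.isMarkovKernel
  obtain ⟨m, hm_prob, hm⟩ :=
    GSpaces.exists_isProbabilityMeasure_quasiMeasurePreserving_mul_right G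
  obtain ⟨Dτ, hDτ⟩ := GSpaces.exists_isDisintegration ρ hτ.measurable
  obtain ⟨Dψ, hDψ⟩ := GSpaces.exists_isDisintegration ρ hψ.measurable
  rw [hτ.map_eq] at hDτ
  rw [hψ.map_eq] at hDψ
  have := hDτ.isMarkovKernel
  have := hDψ.isMarkovKernel
  have hjoin : ρ.map (fun w => (ψ w, τ w)) = GSpaces.independentRelativeJoining ζ Dπ Dφ := by
    refine GSpaces.map_prodMk_eq_independentRelativeJoining hψ.measurable hτ.measurable hDτ hDφ ?_
    let E : Kernel Y X := Dτ.map ψ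
    have hE (y : Y) : E y = (Dτ y).map ψ := Kernel.map_apply _ hψ.measurable y
    have : IsMarkovKernel E := Kernel.IsMarkovKernel.map _ hψ.measurable
    have hED : GSpaces.IsDisintegration ν ζ π (E ∘ₖ Dφ) := by
      refine hDφ.comp hπ.measurable ?_ ?_
      · filter_upwards [hDτ.ae_ae_fiber, hDτ.ae_ae hcomm] with y h1 h2
        have hy : MeasurableSet (π ⁻¹' {φ y}) := hπ.measurable (measurableSet_singleton _)
        rw [hE]
        refine (ae_map_iff hψ.measurable.aemeasurable hy).2 ?_
        filter_upwards [h1, h2] with w h3 h4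
        exact h4.trans (congrArg φ h3)
      · rw [← hψ.map_eq, ← hDτ.bind_eq, GSpaces.map_bind Dτ.measurable hψ.measurable]
        exact Measure.bind_congr_right (.of_forall hE)
    have key := hφ_contr.ae_ae_eq_of_bind_eq hm hY hZ hDφ E Dπ ?_ (hπ_mp Dπ hDπ) ?_
    · simpa only [hE] using key
    · intro g
      filter_upwards [hτ_mp Dτ hDτ g, hDτ.ae_ae (hψ.equivariant g)] with y h1 h2
      rw [hE, hE, h1, GSpaces.translate, GSpaces.translate,
        Measure.map_map hψ.measurable (measurable_const_smul g),
        Measure.map_map (measurable_const_smul g) hψ.measurable]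
      exact Measure.map_congr h2
    · filter_upwards [hED.ae_eq hπ.measurable hDπ] with z hz
      rw [← hz, Kernel.comp_apply]
  rw [← hjoin]
  let α : W → X × Y := fun w => (ψ w, τ w)
  have hα_meas : Measurable α := hψ.measurable.prodMk hτ.measurable
  change GSpaces.IsGSpace G (ρ.map α) ∧ GSpaces.GIsomorphic G ρ (ρ.map α)
  have : MeasurableConstSMul G (X × Y) :=
    ⟨fun g => (measurable_fst.const_smul g).prodMk (measurable_snd.const_smul g)⟩
  have hα : GSpaces.IsGMap G ρ (ρ.map α) α := by
    refine ⟨hα_meas, rfl, fun g => ?_⟩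
    filter_upwards [hψ.equivariant g, hτ.equivariant g] with w h1 h2
    exact Prod.ext h1 h2
  have hαG := hα.isGSpace hW
  refine ⟨hαG, ?_⟩
  obtain ⟨D, hD⟩ := GSpaces.exists_isDisintegration ρ hα_meas
  have := hD.isMarkovKernel
  -- Here τ is the second coordinate of α, so the relative invariance of τ passes to the finer map
  -- α.
  have hD_equiv (g : G) : ∀ᵐ v ∂ρ.map α, D (g • v) = GSpaces.translate g (D v) :=
    GSpaces.IsRelMeasurePreserving.ae_equivariant_of_comp (p := Prod.snd) hW hY hα measurable_snd
      hτ_mp hDτ hD g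
  have hdirac : ∀ᵐ w ∂ρ, D (α w) = Measure.dirac w := by
    let E : Kernel W W := D.comap α hα_meas
    have : IsMarkovKernel E := ⟨fun w => inferInstanceAs (IsProbabilityMeasure (D (α w)))⟩
    refine hψ_contr.ae_eq_dirac_of_bind_eq hm hW hX hDψ E (fun g => ?_) ?_
    · filter_upwards [ae_of_ae_map hα_meas.aemeasurable (hD_equiv g), hα.equivariant g]
        with w h1 h2
      change D (α (g • w)) = GSpaces.translate g (D (α w))
      rw [h2, h1]
    -- D(α w) lives on the α-fiber of w, hence inside its ψ-fiber, so averaging it over D_ψ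
    -- disintegrates ρ over ν again.
    · have hED : GSpaces.IsDisintegration ρ ν ψ (E ∘ₖ Dψ) := by
        refine hDψ.comp hψ.measurable ?_ ?_
        · filter_upwards [ae_of_ae_map hα_meas.aemeasurable hD.ae_ae_fiber] with w hw
          filter_upwards [hw] with w' hw'
          exact congrArg Prod.fst hw'
        · exact (GSpaces.bind_map hα_meas D.measurable).symm.trans hD.bind_eq
      filter_upwards [hED.ae_eq hψ.measurable hDψ] with x hx
      rw [← Kernel.comp_apply, hx]
  obtain ⟨h, hh, hhα⟩ := GSpaces.exists_measurable_ae_leftInverse hα_meas hdirac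
  refine ⟨α, h, hα, ⟨hh, ?_, fun g => ?_⟩, hhα, ?_⟩
  · rw [Measure.map_map hh hα_meas]
    exact (Measure.map_congr hhα).trans Measure.map_id
  · refine (ae_map_iff hα_meas.aemeasurable (measurableSet_eq_fun
      (hh.comp (measurable_const_smul g)) (hh.const_smul g))).2 ?_
    filter_upwards [hhα, hW.ae_smul g hhα, hα.equivariant g] with w h1 h2 h3
    change h (g • α w) = g • h (α w)
    rw [h1, ← h3, h2]
  · refine (ae_map_iff hα_meas.aemeasurable (measurableSet_eq_fun
      (hα_meas.comp hh) measurable_id)).2 ?_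
    filter_upwards [hhα] with w hw
    exact congrArg α hw
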